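/- Let $G$ be a finite simple graph. Write $d(x)$ for the degree of $x$ in $G$, $M_r(v)$ for the set of vertices at distance at most $r$ from $v$, and $G_r(v)$ (the ball of radius $r$ centred at $v$) for the subgraph of $G$ induced by $M_r(v)$. A vertex $x$ of $G_r(v)$ is an interior vertex of $G_r(v)$ if $G_1(x)$ is a subgraph of $G_r(v)$. A graph is $2$-connected if it has at least three vertices and is connected and remains connected after the deletion of any one vertex. A cycle $C$ of $G$ is dominating if $V(G)\setminus V(C)$ is an independent set. Consider the following two conditions. (L) $G$ is connected and has at least three vertices, every ball of radius $4$ in $G$ is $2$-connected, and $$d(x)+d(y)+d(z)\ \ge\ |M_4(v)|+2$$ for every vertex $v\in V(G)$ and all triples of distinct, pairwise non-adjacent interior vertices $x,y,z$ of $G_4(v)$. (B) $G$ is $2$-connected and $d(x)+d(y)+d(z)\ge |V(G)|+2$ for all triples of distinct, pairwise non-adjacent vertices $x,y,z$ of $G$. If $G$ satisfies (L), then every longest cycle of $G$ is dominating. Moreover, $G$ satisfies (L) if and only if it satisfies (B), the hypothesis of Bondy's theorem (which asserts that every longest cycle of a graph satisfying (B) is dominating). -/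

import Mathlib

namespace LocalBondy

universe u

variable {V : Type u}

/-- `k`-connectedness of a graph: more than `k` vertices, and deleting fewer than `k` vertices
always leaves a connected graph. -/
def IsKConnected (k : ℕ) (G : SimpleGraph V) : Prop :=
  (k : ℕ∞) < ENat.card V ∧
    ∀ X : Finset V, X.card < k → (G.induce ((X : Set V)ᶜ)).Connected

/-- `M_r(v)`: the set of all vertices at distance at most `r` from `v`. The extended distance is
used, so vertices in other components (at infinite distance) are not included. -/
def M (G : SimpleGraph V) (r : ℕ) (v : V) : Set V :=
  {w | G.edist v w ≤ (r : ℕ∞)}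

/-- The ball `G_r(v)`: the subgraph of `G` induced by `M_r(v)`. -/
def ball (G : SimpleGraph V) (r : ℕ) (v : V) : G.Subgraph :=
  (⊤ : G.Subgraph).induce (M G r v)

/-- `x` is an interior vertex of the ball `G_r(v)`: it is a vertex of `G_r(v)` and the ball
`G_1(x)` is a subgraph of `G_r(v)`. -/
def IsInterior (G : SimpleGraph V) (r : ℕ) (v x : V) : Prop :=
  x ∈ (ball G r v).verts ∧ ball G 1 x ≤ ball G r v

/-- `x, y, z` are three distinct, pairwise non-adjacent vertices of `G`. -/
def IsIndepTriple (G : SimpleGraph V) (x y z : V) : Prop :=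
  x ≠ y ∧ x ≠ z ∧ y ≠ z ∧ G.IsIndepSet {x, y, z}

/-- The closed walk `C` is a cycle of maximum length in `G`. -/
def IsLongestCycle (G : SimpleGraph V) {a : V} (C : G.Walk a a) : Prop :=
  C.IsCycle ∧ ∀ (b : V) (D : G.Walk b b), D.IsCycle → D.length ≤ C.length

/-- The vertices of `G` outside the closed walk `C` form an independent set. -/
def IsDominating (G : SimpleGraph V) {a : V} (C : G.Walk a a) : Prop :=
  G.IsIndepSet {w | w ∉ C.support}

/-- The local condition: `G` is connected with at least three vertices, every ball of radius `4`
is 2-connected, and `d(x) + d(y) + d(z) ≥ |M_4(v)| + 2` for every vertex `v` and every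
independent triple of interior vertices of `G_4(v)`. -/
def LocalCondition [Fintype V] (G : SimpleGraph V) [DecidableRel G.Adj] : Prop :=
  G.Connected ∧ 3 ≤ Fintype.card V ∧
    (∀ v : V, IsKConnected 2 (ball G 4 v).coe) ∧
    ∀ v x y z : V, IsInterior G 4 v x → IsInterior G 4 v y → IsInterior G 4 v z →
      IsIndepTriple G x y z →
      (M G 4 v).ncard + 2 ≤ G.degree x + G.degree y + G.degree z

/-- Bondy's condition: `G` is 2-connected and `d(x) + d(y) + d(z) ≥ |V(G)| + 2` for every
independent triple of vertices. -/
def BondyCondition [Fintype V] (G : SimpleGraph V) [DecidableRel G.Adj] : Prop :=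
  IsKConnected 2 G ∧
    ∀ x y z : V, IsIndepTriple G x y z →
      Fintype.card V + 2 ≤ G.degree x + G.degree y + G.degree z

end LocalBondy

/-! The local condition is equivalent to the global one because it bounds the radius. Three vertices
within distance 3 of `c` and pairwise at distance at least 3 would be independent interior vertices
of the ball of radius 4 about `c`, with disjoint neighbourhoods inside it, so their degree sum would
be too small. A metric argument (`exists_forall_dist_le_four`) shows that excluding such triples
forces some ball of radius 4 to be the whole graph. There every vertex is interior, and the local
degree bound is the global one.

Conversely, the degree bound passes to balls at once, since a ball has at most as many vertices as
the graph. Only 2-connectedness of the balls needs work (`BondyCondition.linked_ball`): a separated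
pair on the spheres of radius 3 and 4 would form, with the centre, a triple of small degree sum.

Domination is then Bondy's theorem. If two adjacent vertices lie off a longest cycle, their
component off the cycle attaches to it by two disjoint edges `xa`, `hb`. With `a'`, `b'` the
successors of `a`, `b`, a degree count based on forbidden reroutings (`degree_sum_le_of_longest`)
gives the independent triple `x`, `a'`, `b'` degree sum at most |V| + 1. -/

namespace LocalBondy

universe u

variable {V : Type u}

/-! ### Walks as vertex lists, and linking inside a vertex set -/

/-- `l` is the list of vertices of a walk from `p` to `q`. -/
def IsWalkList (G : SimpleGraph V) (p : V) (l : List V) (q : V) : Prop :=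
  ∃ W : G.Walk p q, W.support = l

/-- `p` and `q` are joined by a walk all of whose vertices lie in `S`. -/
def Linked (G : SimpleGraph V) (S : Set V) (p q : V) : Prop :=
  ∃ W : G.Walk p q, ∀ v ∈ W.support, v ∈ S

namespace IsWalkList

variable {G : SimpleGraph V} {p q r s v w : V} {l l₁ l₂ m : List V}

theorem single (G : SimpleGraph V) (p : V) : IsWalkList G p [p] p :=
  ⟨.nil, rfl⟩

theorem append (h : IsWalkList G p l q) (hqr : G.Adj q r) (h' : IsWalkList G r m s) :
    IsWalkList G p (l ++ m) s := by
  obtain ⟨W, rfl⟩ := h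
  obtain ⟨W', rfl⟩ := h'
  exact ⟨W.append (.cons hqr W'), by simp [SimpleGraph.Walk.support_append]⟩

theorem reverse (h : IsWalkList G p l q) : IsWalkList G q l.reverse p := by
  obtain ⟨W, rfl⟩ := h
  exact ⟨W.reverse, by simp⟩

theorem cons_eq (h : IsWalkList G p (v :: l) q) : p = v := by
  obtain ⟨W, hW⟩ := h
  have := W.cons_tail_support.symm
  rw [hW] at this
  exact (List.cons.inj this).1.symm

theorem exists_cons (h : IsWalkList G p l q) : ∃ t, l = p :: t := by
  obtain ⟨W, rfl⟩ := h
  exact ⟨_, W.cons_tail_support.symm⟩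

theorem tail (h : IsWalkList G p (v :: w :: l) q) : G.Adj v w ∧ IsWalkList G w (w :: l) q := by
  obtain ⟨W, hW⟩ := h
  cases W with
  | nil => simp at hW
  | cons h W =>
    simp only [SimpleGraph.Walk.support_cons, List.cons.injEq] at hW
    obtain ⟨rfl, hW⟩ := hW
    have h2 := (show IsWalkList G _ (w :: l) q from ⟨W, hW⟩)
    obtain rfl := h2.cons_eq
    exact ⟨h, h2⟩

theorem split : ∀ {l₁ : List V} {p : V}, IsWalkList G p (l₁ ++ v :: w :: l₂) q →
    IsWalkList G p (l₁ ++ [v]) v ∧ G.Adj v w ∧ IsWalkList G w (w :: l₂) q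
  | [], p, h => by
    simp only [List.nil_append] at h ⊢
    obtain rfl := h.cons_eq
    exact ⟨single _ _, h.tail⟩
  | [c], p, h => by
    obtain rfl := h.cons_eq
    have h1 := h.tail
    exact ⟨(single _ _).append h1.1 (single _ _), h1.2.tail⟩
  | c :: d :: t, p, h => by
    obtain rfl := h.cons_eq
    have h1 := h.tail
    have h2 := split (l₁ := d :: t) h1.2
    exact ⟨(single _ _).append h1.1 h2.1, h2.2⟩

theorem getLast_eq (h : IsWalkList G p (l ++ [v]) q) : q = v := by
  have := h.reverse
  simp only [List.reverse_append, List.reverse_cons, List.reverse_nil, List.nil_append,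
    List.singleton_append] at this
  exact this.cons_eq

theorem exists_isCycle (h : IsWalkList G p l q) (hqp : G.Adj q p) (hl : l.Nodup)
    (h3 : 3 ≤ l.length) : ∃ C : G.Walk q q, C.IsCycle ∧ C.length = l.length := by
  obtain ⟨W, rfl⟩ := h
  have hW : W.IsPath := (SimpleGraph.Walk.isPath_def _).2 hl
  refine ⟨.cons hqp W, (SimpleGraph.Walk.cons_isCycle_iff _ _).2 ⟨hW, fun he => ?_⟩, by simp⟩
  have := hW.length_eq_one_of_mem_edges (Sym2.eq_swap ▸ he)
  simp at h3
  omega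

end IsWalkList

namespace Linked

variable {G : SimpleGraph V} {S T : Set V} {p q r : V}

theorem refl (hp : p ∈ S) : Linked G S p p := ⟨.nil, by simpa⟩

theorem symm (h : Linked G S p q) : Linked G S q p := by
  obtain ⟨W, hW⟩ := h
  exact ⟨W.reverse, by simpa using hW⟩

theorem trans (h : Linked G S p q) (h' : Linked G S q r) : Linked G S p r := by
  obtain ⟨W, hW⟩ := h
  obtain ⟨W', hW'⟩ := h'
  exact ⟨W.append W', fun v hv => by
    rcases SimpleGraph.Walk.mem_support_append_iff _ _ |>.1 hv with h | h
    exacts [hW v h, hW' v h]⟩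

theorem of_adj (h : G.Adj p q) (hp : p ∈ S) (hq : q ∈ S) : Linked G S p q :=
  ⟨.cons h .nil, by simp [hp, hq]⟩

theorem left_mem (h : Linked G S p q) : p ∈ S := by
  obtain ⟨W, hW⟩ := h
  exact hW _ W.start_mem_support

theorem right_mem (h : Linked G S p q) : q ∈ S := h.symm.left_mem

theorem mono (hST : S ⊆ T) (h : Linked G S p q) : Linked G T p q := by
  obtain ⟨W, hW⟩ := h
  exact ⟨W, fun v hv => hST (hW v hv)⟩

/-- The vertices are recorded as linked to `p`, not merely as members of `S`: the rerouting
arguments need them in the component of `p`. -/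
theorem exists_isWalkList (h : Linked G S p q) :
    ∃ l, IsWalkList G p l q ∧ l.Nodup ∧ ∀ v ∈ l, Linked G S p v := by
  classical
  obtain ⟨W, hW⟩ := h
  refine ⟨W.bypass.support, ⟨_, rfl⟩, W.bypass_isPath.support_nodup, fun v hv => ?_⟩
  have hv' := W.support_bypass_subset_support hv
  exact ⟨W.takeUntil v hv', fun w hw => hW w (W.support_takeUntil_subset_support hv' hw)⟩

theorem iff_reachable (hp : p ∈ S) (hq : q ∈ S) :
    Linked G S p q ↔ (G.induce S).Reachable ⟨p, hp⟩ ⟨q, hq⟩ := by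
  constructor
  · rintro ⟨W, hW⟩
    exact ⟨W.induce S hW⟩
  · rintro ⟨W⟩
    refine ⟨W.map (SimpleGraph.Embedding.induce S).toHom, fun v hv => ?_⟩
    have hs := SimpleGraph.Walk.support_map (f := (SimpleGraph.Embedding.induce (G := G) S).toHom) W
    obtain ⟨y, -, rfl⟩ := List.mem_map.1 (hs ▸ hv)
    exact y.2

/-- A walk inside `S` from a set `A` to its complement uses an edge leaving `A`. -/
theorem exists_adj_boundary (h : Linked G S p q) (A : Set V) (hp : p ∈ A) (hq : q ∉ A) :
    ∃ c d, c ∈ A ∧ d ∉ A ∧ G.Adj c d ∧ c ∈ S ∧ d ∈ S := by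
  obtain ⟨W, hW⟩ := h
  obtain ⟨d, hd, h1, h2⟩ := W.exists_boundary_dart A hp hq
  exact ⟨d.fst, d.snd, h1, h2, d.adj, hW _ (W.dart_fst_mem_support_of_mem_darts hd),
    hW _ (W.dart_snd_mem_support_of_mem_darts hd)⟩

/-- A walk inside `S` from a set `A` to its complement uses an edge leaving `A`, the part of the
walk before this edge lying in `A`. -/
theorem exists_boundary (h : Linked G S p q) (A : Set V) (hp : p ∈ A) (hq : q ∉ A) :
    ∃ c d, Linked G (S ∩ A) p c ∧ d ∉ A ∧ G.Adj c d ∧ d ∈ S := by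
  obtain ⟨c, d, hc, hd, hcd, hcS, hdS⟩ := h.exists_adj_boundary {c | Linked G (S ∩ A) p c}
    (refl ⟨h.left_mem, hp⟩) (fun h' => hq h'.right_mem.2)
  refine ⟨c, d, hc, fun hdA => hd ?_, hcd, hdS⟩
  exact hc.trans (of_adj hcd hc.right_mem ⟨hdS, hdA⟩)

end Linked

/-! ### Counting along lists with forbidden shifted pairs -/

section Counting

variable (R S T : V → ℕ)

/-- Pair `T` at each position with `S` at the next; only `T` at the last position is left unpaired.
-/
theorem sum_map_add_sum_map_tail_le (hT : ∀ v, T v ≤ 1) (hS : ∀ v, S v ≤ 1) :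
    ∀ {c : V} {l : List V}, (∀ l₁ l₂ v w, c :: l = l₁ ++ v :: w :: l₂ → T v + S w ≤ 1) →
      ((c :: l).map T).sum + (l.map S).sum ≤ l.length + 1
  | c, [], _ => by simpa using hT c
  | c, d :: l, h => by
    have h1 := h [] l c d rfl
    have h2 := sum_map_add_sum_map_tail_le hT hS (c := d) (l := l) fun l₁ l₂ v w e =>
      h (c :: l₁) l₂ v w (by rw [e]; rfl)
    simp only [List.map_cons, List.sum_cons, List.length_cons] at h2 ⊢
    omega

/-- Of `R` at position i, `S` at i + 1 and `T` at i + 2, at most one is nonzero. The final `R`-`S`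
pair and the last `R` remain, which gives the 2. -/
theorem sum_map_three_aux (hS : ∀ v, S v ≤ 1) (hR : ∀ v, R v ≤ 1) :
    ∀ {c d : V} {l : List V},
      (∀ l₁ l₂ v w, c :: d :: l = l₁ ++ v :: w :: l₂ → S v + T w ≤ 1) →
      (∀ l₁ l₂ v w, c :: d :: l = l₁ ++ v :: w :: l₂ → R v + S w ≤ 1) →
      (∀ l₁ l₂ v z w, c :: d :: l = l₁ ++ v :: z :: w :: l₂ → R v + T w ≤ 1) →
      R c + ((d :: l).map S).sum + (l.map T).sum + ((d :: l).map R).sum ≤ l.length + 2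
  | c, d, [], _, h2, _ => by
    have h1 := h2 [] [] c d rfl
    have := hR d
    simp
    omega
  | c, d, e :: l, h1, h2, h3 => by
    have a1 := h1 [c] l d e rfl
    have a2 := h2 [] (e :: l) c d rfl
    have a3 := h3 [] l c d e rfl
    have ih := sum_map_three_aux hS hR (c := d) (d := e) (l := l)
      (fun l₁ l₂ v w e' => h1 (c :: l₁) l₂ v w (by rw [e']; rfl))
      (fun l₁ l₂ v w e' => h2 (c :: l₁) l₂ v w (by rw [e']; rfl))
      (fun l₁ l₂ v z w e' => h3 (c :: l₁) l₂ v z w (by rw [e']; rfl))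
    simp only [List.map_cons, List.sum_cons, List.length_cons] at ih ⊢
    omega

/-- Restores the initial terms omitted by the shifted count: `T d` vanishes, and `S` at the first
position conflicts with `T` at the second. -/
theorem sum_map_three_le (hS : ∀ v, S v ≤ 1) (hR : ∀ v, R v ≤ 1) {d : V} {l : List V}
    (h0 : T d = 0)
    (h1 : ∀ l₁ l₂ v w, d :: l = l₁ ++ v :: w :: l₂ → S v + T w ≤ 1)
    (h2 : ∀ l₁ l₂ v w, d :: l = l₁ ++ v :: w :: l₂ → R v + S w ≤ 1)
    (h3 : ∀ l₁ l₂ v z w, d :: l = l₁ ++ v :: z :: w :: l₂ → R v + T w ≤ 1) :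
    ((d :: l).map S).sum + ((d :: l).map T).sum + ((d :: l).map R).sum ≤ l.length + 2 := by
  cases l with
  | nil =>
    have := hS d
    have := hR d
    simp
    omega
  | cons e l =>
    have a1 := h1 [] l d e rfl
    have := sum_map_three_aux R S T hS hR h1 h2 h3
    simp only [List.map_cons, List.sum_cons, List.length_cons] at this ⊢
    omega

theorem sum_map_le_of_forall_eq (hR : ∀ v, R v ≤ 1) {b : V} {l : List V} (hl : l.Nodup)
    (h : ∀ v ∈ l, R v ≠ 0 → v = b) : (l.map R).sum ≤ 1 := by
  induction l with
  | nil => simp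
  | cons c l ih =>
    rw [List.nodup_cons] at hl
    simp only [List.map_cons, List.sum_cons]
    by_cases hc : R c = 0
    · have := ih hl.2 fun v hv => h v (List.mem_cons_of_mem _ hv)
      omega
    · have hcb := h c (by simp) hc
      have : (l.map R).sum = 0 := by
        rw [List.sum_eq_zero_iff]
        intro n hn
        obtain ⟨v, hv, rfl⟩ := List.mem_map.1 hn
        by_contra hne
        have := h v (List.mem_cons_of_mem _ hv) hne
        exact hl.1 (hcb ▸ this ▸ hv)
      have := hR c
      omega

end Counting

/-! ### Degree sums around a longest cycle -/

theorem degree_eq_sum [Fintype V] (G : SimpleGraph V) [DecidableRel G.Adj] (p : V) :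
    G.degree p = ∑ v, if G.Adj p v then 1 else 0 := by
  rw [← SimpleGraph.card_neighborFinset_eq_degree, SimpleGraph.neighborFinset_eq_filter,
    Finset.card_filter]

theorem sum_eq_sum_map_add [Fintype V] [DecidableEq V] (f : V → ℕ) {l : List V} (hl : l.Nodup) :
    ∑ v, f v = (l.map f).sum + ∑ v ∈ l.toFinsetᶜ, f v := by
  rw [← Finset.sum_add_sum_compl l.toFinset, List.sum_toFinset _ hl]

/-- Every rerouted cycle uses each vertex at most as often as a known duplicate-free list, so its
simplicity becomes linear arithmetic on counts. -/
theorem nodup_of_count_le [DecidableEq V] {l m : List V} (hl : l.Nodup)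
    (h : ∀ y, m.count y ≤ l.count y) : m.Nodup :=
  List.nodup_iff_count_le_one.2 fun y => (h y).trans (List.nodup_iff_count_le_one.1 hl y)

/-- The degree sum of three vertices bounded by counting over two arcs of a cycle and over the
vertices off the cycle. -/
theorem degree_sum_le_of_arcs [Fintype V] {G : SimpleGraph V} [DecidableRel G.Adj]
    {b a' b' x : V} {L₁' L₂' : List V} (hnd : (a' :: L₁' ++ b' :: L₂').Nodup)
    (hR : ∀ v ∈ a' :: L₁', G.Adj x v → v = b)
    (c₁ : ∀ l₁ l₂ v w, a' :: L₁' = l₁ ++ v :: w :: l₂ → G.Adj b' v → ¬ G.Adj a' w)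
    (c₂ : ∀ l₁ l₂ v w, b' :: L₂' = l₁ ++ v :: w :: l₂ → G.Adj a' v → ¬ G.Adj b' w)
    (c₃ : ∀ l₁ l₂ v w, b' :: L₂' = l₁ ++ v :: w :: l₂ → G.Adj x v → ¬ G.Adj a' w)
    (c₄ : ∀ l₁ l₂ v z w, b' :: L₂' = l₁ ++ v :: z :: w :: l₂ → G.Adj x v → ¬ G.Adj b' w)
    (hxH : x ∉ a' :: L₁' ++ b' :: L₂')
    (hoff : ∀ w, w ∉ a' :: L₁' ++ b' :: L₂' → (G.Adj a' w → ¬ G.Adj b' w) ∧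
      (G.Adj x w → ¬ G.Adj a' w) ∧ (G.Adj x w → ¬ G.Adj b' w))
    (hxa : ¬ G.Adj x a') (hxb : ¬ G.Adj x b') :
    G.degree x + G.degree a' + G.degree b' ≤ Fintype.card V + 1 := by
  classical
  obtain ⟨hnd1, -, -⟩ := List.nodup_append.1 hnd
  set f : V → V → ℕ := fun p v => if G.Adj p v then 1 else 0 with hf
  have f1 : ∀ p v, f p v ≤ 1 := fun p v => by simp only [hf]; split_ifs <;> simp
  have f2 : ∀ p q v w, (G.Adj p v → ¬ G.Adj q w) → f p v + f q w ≤ 1 := by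
    intro p q v w h
    simp only [hf]
    split_ifs with h1 h2
    exacts [absurd h2 (h h1), le_rfl, le_rfl, Nat.zero_le _]
  have e₁ := sum_map_add_sum_map_tail_le (f a') (f b') (f1 _) (f1 _) (c := a') (l := L₁')
    fun l₁ l₂ v w e => f2 _ _ _ _ (c₁ l₁ l₂ v w e)
  have e₂ := sum_map_le_of_forall_eq (f x) (f1 _) hnd1 (b := b) fun v hv hne =>
    hR v hv (by by_contra hn; simp [hf, hn] at hne)
  have e₃ := sum_map_three_le (f x) (f a') (f b') (f1 _) (f1 _) (d := b') (l := L₂')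
    (by simp [hf]) (fun l₁ l₂ v w e => f2 _ _ _ _ (c₂ l₁ l₂ v w e))
    (fun l₁ l₂ v w e => f2 _ _ _ _ (c₃ l₁ l₂ v w e))
    (fun l₁ l₂ v z w e => f2 _ _ _ _ (c₄ l₁ l₂ v z w e))
  have e₀ : (((a' :: L₁').map (f a')).sum = (L₁'.map (f a')).sum) := by
    simp [hf]
  -- The arcs contribute at most their lengths plus one each. Off the cycle each vertex is adjacent
  -- to at most one of the three, and `x` to none; this saves one and brings |V| + 2 down to |V| +
  -- 1.
  have e₄ : ∑ v ∈ (a' :: L₁' ++ b' :: L₂').toFinsetᶜ, (f x v + f a' v + f b' v) + 1 ≤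
      (a' :: L₁' ++ b' :: L₂').toFinsetᶜ.card := by
    have hxmem : x ∈ (a' :: L₁' ++ b' :: L₂').toFinsetᶜ := by
      rw [Finset.mem_compl, List.mem_toFinset]
      exact hxH
    rw [← Finset.add_sum_erase _ _ hxmem, ← Finset.card_erase_add_one hxmem]
    have hx0 : f x x + f a' x + f b' x = 0 := by
      have h1 : ¬ G.Adj a' x := fun h => hxa h.symm
      have h2 : ¬ G.Adj b' x := fun h => hxb h.symm
      simp [hf, h1, h2]
    rw [hx0, zero_add]
    gcongr
    rw [Finset.card_eq_sum_ones]
    refine Finset.sum_le_sum fun w hw => ?_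
    have hwH : w ∉ a' :: L₁' ++ b' :: L₂' := by
      have := Finset.mem_of_mem_erase hw
      rwa [Finset.mem_compl, List.mem_toFinset] at this
    obtain ⟨o1, o2, o3⟩ := hoff w hwH
    have g1 := f2 _ _ w w o1
    have g2 := f2 _ _ w w o2
    have g3 := f2 _ _ w w o3
    have g4 := f1 x w
    omega
  have hcard : (a' :: L₁' ++ b' :: L₂').toFinsetᶜ.card + (a' :: L₁' ++ b' :: L₂').length =
      Fintype.card V := by
    rw [← List.toFinset_card_of_nodup hnd, Finset.card_compl_add_card]
  have e₅ := sum_eq_sum_map_add (f x) hnd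
  have e₆ := sum_eq_sum_map_add (f a') hnd
  have e₇ := sum_eq_sum_map_add (f b') hnd
  rw [degree_eq_sum G x, degree_eq_sum G a', degree_eq_sum G b']
  simp only [Finset.sum_add_distrib] at e₄
  rw [List.map_append, List.sum_append] at e₅ e₆ e₇
  rw [List.length_append, List.length_cons, List.length_cons] at hcard
  change ∑ v, f x v + ∑ v, f a' v + ∑ v, f b' v ≤ _
  omega

theorem isIndepTriple_of_not_adj {G : SimpleGraph V} {x y z : V}
    (hxy : x ≠ y) (hxz : x ≠ z) (hyz : y ≠ z)
    (axy : ¬ G.Adj x y) (axz : ¬ G.Adj x z) (ayz : ¬ G.Adj y z) : IsIndepTriple G x y z := by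
  refine ⟨hxy, hxz, hyz, fun c hc d hd _ hcd => ?_⟩
  simp only [Set.mem_insert_iff, Set.mem_singleton_iff] at hc hd
  rcases hc with rfl | rfl | rfl <;> rcases hd with rfl | rfl | rfl <;>
    first
    | exact hcd.ne rfl
    | exact axy hcd
    | exact axy hcd.symm
    | exact axz hcd
    | exact axz hcd.symm
    | exact ayz hcd
    | exact ayz hcd.symm

set_option linter.unusedSimpArgs false in
set_option maxHeartbeats 1000000 in
/-- Two disjoint arcs of a longest cycle together with a path `P` off the cycle which joins their
ends: the degree sum of the first vertices of the arcs and of the first vertex of `P` is at most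
the number of vertices plus one. -/
theorem degree_sum_le_of_longest [Fintype V] {G : SimpleGraph V} [DecidableRel G.Adj]
    {a b a' b' x h : V} {L₁ L₂ P : List V}
    (h₁ : IsWalkList G a' L₁ b) (h₂ : IsWalkList G b' L₂ a) (hb : G.Adj b b') (ha : G.Adj a a')
    (hnd : (L₁ ++ L₂).Nodup) (h3 : 3 ≤ (L₁ ++ L₂).length)
    (hmax : ∀ p l q, IsWalkList G p l q → G.Adj q p → l.Nodup → 3 ≤ l.length →
      l.length ≤ (L₁ ++ L₂).length)
    (hP : IsWalkList G x P h) (hPnd : P.Nodup)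
    (hPoff : ∀ v ∈ P, Linked G {v | v ∉ L₁ ++ L₂} x v)
    (hxh : x ≠ h) (hax : G.Adj a x) (hhb : G.Adj h b) (hR : ∀ v ∈ L₁, G.Adj x v → v = b) :
    IsIndepTriple G x a' b' ∧
      G.degree x + G.degree a' + G.degree b' ≤ Fintype.card V + 1 := by
  classical
  have hlong : ∀ p l q, IsWalkList G p l q → G.Adj q p → l.Nodup →
      ¬ (L₁ ++ L₂).length < l.length := fun p l q h h' h'' h4 =>
    absurd (hmax p l q h h' h'' (by omega)) (by omega)
  obtain ⟨-, -, hdis⟩ := List.nodup_append.1 hnd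
  have hPd : ∀ v ∈ P, v ∉ L₁ ∧ v ∉ L₂ := fun v hv => by
    simpa using (hPoff v hv).right_mem
  obtain ⟨P', rfl⟩ := hP.exists_cons
  obtain ⟨L₁', rfl⟩ := h₁.exists_cons
  obtain ⟨L₂', rfl⟩ := h₂.exists_cons
  have hP2 : 2 ≤ (x :: P').length := by
    cases P' with
    | nil => exact absurd (IsWalkList.getLast_eq (l := []) hP).symm hxh
    | cons c P' => simp
  set H : Set V := {v | v ∉ a' :: L₁' ++ b' :: L₂'}
  have hxH : x ∈ H := (hPoff x (by simp)).left_mem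
  have hxx : Linked G H x x := .refl hxH
  have hxlink : Linked G H x h := hPoff h (by
    have := hP.reverse.exists_cons
    obtain ⟨t, ht⟩ := this
    have : h ∈ (x :: P').reverse := ht ▸ by simp
    exact List.mem_reverse.1 this)
  have hN : (x :: P' ++ (a' :: L₁' ++ b' :: L₂')).Nodup :=
    List.nodup_append.2 ⟨hPnd, hnd, fun v hv w hw e => (hPoff v hv).right_mem (e ▸ hw)⟩
  -- A path off the cycle from `x` to `w` could be inserted between `a` and `a'`.
  have hoffa : ∀ w, Linked G H x w → ¬ G.Adj w a' := by
    intro w hw hwa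
    obtain ⟨Q, hQ, hQnd, hQoff⟩ := hw.exists_isWalkList
    have hQd : ∀ v ∈ Q, v ∉ a' :: L₁' ++ b' :: L₂' := fun v hv => (hQoff v hv).right_mem
    obtain ⟨Q', rfl⟩ := hQ.exists_cons
    refine hlong _ _ _ ((hQ.append hwa h₁).append hb h₂) hax ?_ (by simp)
    have hQN := List.nodup_append.2 ⟨hQnd, hnd, fun v hv w hw e => hQd v hv (e ▸ hw)⟩
    refine nodup_of_count_le hQN fun y => ?_
    simp only [List.count_append, List.count_cons, List.count_reverse, List.count_nil]
    omega
  have hoffb : ∀ w, Linked G H x w → ¬ G.Adj w b' := by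
    intro w hw hwb
    obtain ⟨Q, hQ, hQnd, hQoff⟩ := (hxlink.symm.trans hw).exists_isWalkList
    have hQd : ∀ v ∈ Q, v ∉ a' :: L₁' ++ b' :: L₂' := fun v hv => (hQoff v hv).right_mem
    obtain ⟨Q', rfl⟩ := hQ.exists_cons
    refine hlong _ _ _ ((hQ.append hwb h₂).append ha h₁) hhb.symm ?_ (by simp; omega)
    have hQN := List.nodup_append.2 ⟨hQnd, hnd, fun v hv w hw e => hQd v hv (e ▸ hw)⟩
    refine nodup_of_count_le hQN fun y => ?_
    simp only [List.count_append, List.count_cons, List.count_reverse, List.count_nil]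
    omega
  -- In this and most later reroutings the edges `aa'` and `bb'` are dropped, `P` joins `a` to `b`,
  -- and the arcs are cut and rejoined through the supposed adjacencies.
  have hab : ¬ G.Adj a' b' := by
    intro hadj
    refine hlong _ _ _ ((hP.append hhb h₁.reverse).append hadj h₂) hax ?_ (by simp; omega)
    refine nodup_of_count_le hN fun y => ?_
    simp only [List.count_append, List.count_cons, List.count_reverse, List.count_nil]
    omega
  have hoffab : ∀ w ∈ H, G.Adj a' w → ¬ G.Adj b' w := by
    intro w hw hwa hwb
    have hwP : w ∉ x :: P' := fun hwP => hoffa w (hPoff w hwP) hwa.symm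
    have hw' : w ∉ a' :: L₁' ++ b' :: L₂' := hw
    refine hlong _ _ _ (((hP.append hhb h₁.reverse).append hwa (.single G w)).append hwb.symm h₂)
      hax ?_ (by simp; omega)
    have hwN : (w :: (x :: P' ++ (a' :: L₁' ++ b' :: L₂'))).Nodup :=
      List.nodup_cons.2 ⟨fun h => by
        rcases List.mem_append.1 h with h | h
        exacts [hwP h, hw' h], hN⟩
    refine nodup_of_count_le hwN fun y => ?_
    simp only [List.count_append, List.count_cons, List.count_reverse, List.count_nil]
    omega
  have c₁ : ∀ l₁ l₂ v w, a' :: L₁' = l₁ ++ v :: w :: l₂ → G.Adj b' v → ¬ G.Adj a' w := by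
    intro l₁ l₂ v w e hv hw
    rw [e] at h₁
    have hs := h₁.split
    refine hlong _ _ _ (((hP.append hhb hs.2.2.reverse).append hw.symm hs.1).append hv.symm h₂)
      hax ?_ (by rw [e]; simp; omega)
    refine nodup_of_count_le hN fun y => ?_
    simp only [e, List.count_append, List.count_cons, List.count_reverse, List.count_nil]
    omega
  have c₂ : ∀ l₁ l₂ v w, b' :: L₂' = l₁ ++ v :: w :: l₂ → G.Adj a' v → ¬ G.Adj b' w := by
    intro l₁ l₂ v w e hv hw
    rw [e] at h₂
    have hs := h₂.split
    refine hlong _ _ _ (((hP.append hhb h₁.reverse).append hv hs.1.reverse).append hw hs.2.2)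
      hax ?_ (by rw [e]; simp; omega)
    refine nodup_of_count_le hN fun y => ?_
    simp only [e, List.count_append, List.count_cons, List.count_reverse, List.count_nil]
    omega
  -- Here only `x` is inserted, between `a` and `v`, and `bb'` is kept.
  have c₃ : ∀ l₁ l₂ v w, b' :: L₂' = l₁ ++ v :: w :: l₂ → G.Adj x v → ¬ G.Adj a' w := by
    intro l₁ l₂ v w e hv hw
    rw [e] at h₂
    have hs := h₂.split
    refine hlong _ _ _ ((((IsWalkList.single G x).append hv hs.1.reverse).append hb.symm
      h₁.reverse).append hw hs.2.2) hax ?_ (by rw [e]; simp; omega)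
    refine nodup_of_count_le hN fun y => ?_
    simp only [e, List.count_append, List.count_cons, List.count_reverse, List.count_nil]
    omega
  -- This rerouting omits `z`, so it is longer only because `P` has at least two vertices.
  have c₄ : ∀ l₁ l₂ v z w, b' :: L₂' = l₁ ++ v :: z :: w :: l₂ → G.Adj x v → ¬ G.Adj b' w := by
    intro l₁ l₂ v z w e hv hw
    rw [e] at h₂
    have hs := h₂.split
    have hs' := (IsWalkList.split (l₁ := l₁ ++ [v]) (v := z) (w := w) (l₂ := l₂)
      (by simpa using h₂)).2.2
    refine hlong _ _ _ (((hP.reverse.append hv hs.1.reverse).append hw hs').append ha h₁)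
      hhb.symm ?_ (by rw [e]; simp at hP2 ⊢; omega)
    refine nodup_of_count_le hN fun y => ?_
    simp only [e, List.count_append, List.count_cons, List.count_reverse, List.count_nil]
    omega
  have hxa : ¬ G.Adj x a' := hoffa x hxx
  have hxb : ¬ G.Adj x b' := hoffb x hxx
  refine ⟨isIndepTriple_of_not_adj (fun e => (hPd x (by simp)).1 (by simp [e]))
    (fun e => (hPd x (by simp)).2 (by simp [e]))
    (fun e => hdis a' (by simp) b' (by simp) e) hxa hxb hab, ?_⟩
  exact degree_sum_le_of_arcs hnd (by simpa using hR) c₁ c₂ c₃ c₄ hxH (fun w hw => ⟨hoffab w hw,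
    fun h h' => hoffa w (.of_adj h hxH hw) h'.symm,
    fun h h' => hoffb w (.of_adj h hxH hw) h'.symm⟩) hxa hxb

/-! ### Attaching a component to the cycle, and Bondy's theorem -/

theorem IsKConnected.linked {G : SimpleGraph V} (h : IsKConnected 2 G) {c p q : V} (hp : p ≠ c)
    (hq : q ≠ c) : Linked G {c}ᶜ p q := by
  have h1 := h.2 {c} (by simp)
  rw [Finset.coe_singleton] at h1
  exact (Linked.iff_reachable (S := {c}ᶜ) hp hq).2 (h1.preconnected _ _)

/-- Two independent edges join a component with at least two vertices of the complement of `S`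
to `S`. -/
theorem exists_two_disjoint_adj {G : SimpleGraph V}
    (hG : ∀ c p q, p ≠ c → q ≠ c → Linked G {c}ᶜ p q) {S : Set V} {u v c d : V}
    (hu : u ∉ S) (hv : v ∉ S) (huv : G.Adj u v) (hc : c ∈ S) (hd : d ∈ S) (hcd : c ≠ d) :
    ∃ x h a b, Linked G Sᶜ x h ∧ x ≠ h ∧ a ∈ S ∧ b ∈ S ∧ a ≠ b ∧ G.Adj x a ∧ G.Adj h b := by
  -- Deleting a vertex of `S` gives an attachment ending elsewhere; deleting a vertex of the
  -- component (`key₂`) gives one starting elsewhere.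
  have key₁ : ∀ e ∈ S, ∃ y f, Linked G Sᶜ u y ∧ f ∈ S ∧ f ≠ e ∧ G.Adj y f := by
    intro e he
    obtain ⟨f, hf, hfe⟩ : ∃ f ∈ S, f ≠ e := by
      by_cases h : c = e
      · exact ⟨d, hd, fun h' => hcd (h.trans h'.symm)⟩
      · exact ⟨c, hc, h⟩
    obtain ⟨y, g, hy, hg, hyg, -, hge⟩ := (hG e u f (fun h => hu (h ▸ he)) hfe).exists_adj_boundary
      {y | Linked G Sᶜ u y} (.refl hu) (fun h => h.right_mem hf)
    exact ⟨y, g, hy, by_contra fun h => hg (hy.trans (.of_adj hyg hy.right_mem h)), hge, hyg⟩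
  have key₂ : ∀ z, Linked G Sᶜ u z → ∃ y f, Linked G Sᶜ u y ∧ y ≠ z ∧ f ∈ S ∧ G.Adj y f := by
    intro z hz
    obtain ⟨w, hw, hwz⟩ : ∃ w, Linked G Sᶜ u w ∧ w ≠ z := by
      by_cases h : u = z
      · exact ⟨v, .of_adj huv hu hv, fun h' => huv.ne (h.trans h'.symm)⟩
      · exact ⟨u, .refl hu, h⟩
    obtain ⟨y, g, hy, hg, hyg, hyz, hgz⟩ := (hG z w c hwz
      (fun h => hz.right_mem (h ▸ hc))).exists_adj_boundary {y | Linked G Sᶜ u y} hw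
      (fun h => h.right_mem hc)
    exact ⟨y, g, hy, hyz, by_contra fun h => hg (hy.trans (.of_adj hyg hy.right_mem h)), hyg⟩
  obtain ⟨x, a, hx, ha, -, hxa⟩ := key₁ c hc
  obtain ⟨y, b, hy, hb, hba, hyb⟩ := key₁ a ha
  -- If both attachments start at `x`, take a third one from another vertex and pair it with
  -- whichever of the first two has a different end.
  by_cases hxy : x = y
  · obtain ⟨z, e, hz, hzx, he, hze⟩ := key₂ x hx
    by_cases hea : e = a
    · exact ⟨y, z, b, e, hy.symm.trans hz, fun h => hzx (hxy.trans h).symm, hb, he,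
        fun h => hba (h.trans hea), hyb, hze⟩
    · exact ⟨x, z, a, e, hx.symm.trans hz, hzx.symm, ha, he, fun h => hea h.symm, hxa, hze⟩
  · exact ⟨x, y, a, b, hx.symm.trans hy, hxy, ha, hb, hba.symm, hxa, hyb⟩

theorem exists_last_split {p : V → Prop} {l : List V} (h : ∃ v ∈ l, p v) :
    ∃ l₁ v l₂, l = l₁ ++ v :: l₂ ∧ p v ∧ ∀ w ∈ l₂, ¬ p w := by
  induction l with
  | nil => simp at h
  | cons c l ih =>
    by_cases hl : ∃ v ∈ l, p v
    · obtain ⟨l₁, v, l₂, rfl, hv, hw⟩ := ih hl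
      exact ⟨c :: l₁, v, l₂, rfl, hv, hw⟩
    · obtain ⟨v, hv, hpv⟩ := h
      rcases List.mem_cons.1 hv with rfl | hv
      · exact ⟨[], v, l, rfl, hpv, fun w hw hpw => hl ⟨w, hw, hpw⟩⟩
      · exact absurd ⟨v, hv, hpv⟩ hl

/-- A cycle, listed so that it ends at a given vertex. -/
theorem exists_isWalkList_of_isCycle {G : SimpleGraph V} {a b : V} {C : G.Walk a a}
    (hC : C.IsCycle) (hb : b ∈ C.support) :
    ∃ p l, IsWalkList G p (l ++ [b]) b ∧ G.Adj b p ∧ (l ++ [b]).Nodup ∧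
      (l ++ [b]).length = C.length ∧ ∀ v, v ∈ l ++ [b] ↔ v ∈ C.support := by
  classical
  have hD := hC.rotate hb
  have hlen := C.length_rotate b hb
  have hmem := fun v => C.mem_support_rotate_iff (w := v) b hb
  generalize C.rotate b hb = D at hD hlen hmem
  cases D with
  | nil => exact absurd rfl hD.ne_nil
  | @cons _ p _ h W =>
    have hnd := hD.support_nodup
    simp only [SimpleGraph.Walk.support_cons, List.tail_cons] at hnd
    have hne := W.support_ne_nil
    have e : W.support.dropLast ++ [b] = W.support := by
      have h1 := List.dropLast_append_getLast hne
      rwa [SimpleGraph.Walk.getLast_support] at h1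
    refine ⟨p, W.support.dropLast, ?_⟩
    rw [e]
    refine ⟨⟨W, rfl⟩, h, hnd, by simpa using hlen, fun v => ?_⟩
    rw [← hmem]
    simp only [SimpleGraph.Walk.support_cons, List.mem_cons]
    exact ⟨Or.inr, fun h => h.elim (fun h => h ▸ W.end_mem_support) id⟩

/-- **Bondy's theorem**. -/
theorem BondyCondition.isDominating [Fintype V] {G : SimpleGraph V} [DecidableRel G.Adj]
    (hG : BondyCondition G) {c : V} {C : G.Walk c c} (hC : IsLongestCycle G C) :
    IsDominating G C := by
  intro u hu v hv _ huv
  have hlen := hC.1.three_le_length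
  obtain ⟨d, hd, hcd⟩ : ∃ d ∈ C.support, c ≠ d := by
    cases C with
    | nil => exact absurd rfl hC.1.ne_nil
    | cons h W => exact ⟨_, by simp, h.ne⟩
  obtain ⟨x, h, a₀, b, hxh, hne, ha₀, hb, hab, hxa, hhb⟩ := exists_two_disjoint_adj
    (fun c p q => hG.1.linked) (S := {v | v ∈ C.support}) hu hv huv C.start_mem_support hd hcd
  obtain ⟨p, l, hl, hbp, hnd, hll, hmem⟩ := exists_isWalkList_of_isCycle hC.1 hb
  -- Replacing `a₀` by the last neighbour of `x` before `b` leaves `b` as the only possible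
  -- neighbour of `x` on the arc from `a'` to `b`.
  obtain ⟨l₁, a, l₂, rfl, hxa, hl₂⟩ := exists_last_split (p := G.Adj x) (l := l)
    ⟨a₀, by simpa [hab] using (hmem a₀).2 ha₀, hxa⟩
  obtain ⟨a', L₁, hL₁⟩ : ∃ a' L₁, l₂ ++ [b] = a' :: L₁ := by
    cases l₂ <;> simp
  have hsplit : l₁ ++ a :: l₂ ++ [b] = l₁ ++ a :: a' :: L₁ := by simp [hL₁]
  obtain ⟨h₂, haa', h₁⟩ := IsWalkList.split (hsplit ▸ hl)
  have hperm : (l₂ ++ [b] ++ (l₁ ++ [a])).Perm (l₁ ++ a :: l₂ ++ [b]) := by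
    refine List.perm_append_comm.trans ?_
    simp
  have hS : {v | v ∈ C.support}ᶜ = {v | v ∉ l₂ ++ [b] ++ (l₁ ++ [a])} := by
    ext v
    simp only [Set.mem_compl_iff, Set.mem_ofPred_eq]
    rw [hperm.mem_iff, hmem]
  rw [hS] at hxh
  obtain ⟨P, hP, hPnd, hPoff⟩ := hxh.exists_isWalkList
  rw [← hL₁] at h₁
  have hlen' := hperm.length_eq.trans hll
  obtain ⟨h3, h4⟩ := degree_sum_le_of_longest h₁ h₂ hbp haa' (hperm.nodup_iff.2 hnd)
    (by omega) (fun p l q hl hqp hn hl3 => by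
      obtain ⟨D, hD, hDl⟩ := hl.exists_isCycle hqp hn hl3
      rw [hlen', ← hDl]
      exact hC.2 _ D hD) hP hPnd hPoff hne hxa.symm hhb (fun w hw hxw => by
      rcases List.mem_append.1 hw with hw | hw
      · exact absurd hxw (hl₂ w hw)
      · simpa using hw)
  have := hG.2 _ _ _ h3
  omega

/-! ### 2-connectedness of balls, interior vertices and distances -/

variable {G : SimpleGraph V}

theorem IsKConnected.connected (h : IsKConnected 2 G) : G.Connected := by
  have h1 := h.2 ∅ (by simp)
  exact h1.map (SimpleGraph.Embedding.induce _).toHom fun v => ⟨⟨v, by simp⟩, rfl⟩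

theorem isKConnected_two_of_linked (hcard : 2 < ENat.card V)
    (h : ∀ c p q, p ≠ c → q ≠ c → Linked G {c}ᶜ p q) : IsKConnected 2 G := by
  have : Nontrivial V := (ENat.one_lt_card_iff_nontrivial V).1 (lt_trans (by norm_num) hcard)
  refine ⟨hcard, fun X hX => ?_⟩
  have key : ∀ p q, p ∉ X → q ∉ X → Linked G (X : Set V)ᶜ p q := by
    intro p q hp hq
    -- When `X` is empty, a third vertex is deleted instead; it exists because there are more than
    -- two vertices.
    obtain ⟨c, hpc, hqc, hX⟩ : ∃ c, p ≠ c ∧ q ≠ c ∧ X ⊆ {c} := by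
      rcases Finset.eq_empty_or_nonempty X with rfl | ⟨c, hc⟩
      · by_contra! hne
        have h1 : (Set.univ : Set V) ⊆ {p, q} := fun c _ => by
          by_contra hc
          simp only [Set.mem_insert_iff, Set.mem_singleton_iff, not_or] at hc
          exact hne c (Ne.symm hc.1) (Ne.symm hc.2) (Finset.empty_subset _)
        have h2 := (Set.encard_le_encard h1).trans ((Set.encard_insert_le {q} p).trans
          (by rw [Set.encard_singleton]; norm_num : _ ≤ (2 : ℕ∞)))
        rw [Set.encard_univ] at h2
        exact absurd hcard (not_lt.2 h2)
      · exact ⟨c, fun h => hp (h ▸ hc), fun h => hq (h ▸ hc), fun d hd =>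
          Finset.mem_singleton.2 (Finset.card_le_one.1 (by omega) d hd c hc)⟩
    refine (h c p q hpc hqc).mono fun v (hv : v ≠ c) hvX => hv ?_
    simpa using hX hvX
  obtain ⟨p, hp⟩ : ∃ p, p ∉ X := by
    by_contra! hall
    obtain ⟨a, b, hab⟩ := exists_pair_ne V
    exact hab (Finset.card_le_one.1 (by omega) a (hall a) b (hall b))
  have : Nonempty ((X : Set V)ᶜ : Set V) := ⟨⟨p, hp⟩⟩
  exact ⟨fun a b => (Linked.iff_reachable a.2 b.2).1 (key a b a.2 b.2)⟩

theorem Linked.of_induce {s : Set V} {T : Set s} {p q : s} (h : Linked (G.induce s) T p q) :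
    Linked G (Subtype.val '' T) p q := by
  obtain ⟨W, hW⟩ := h
  refine ⟨W.map (SimpleGraph.Embedding.induce s).toHom, fun v hv => ?_⟩
  have hs := SimpleGraph.Walk.support_map (f := (SimpleGraph.Embedding.induce (G := G) s).toHom) W
  obtain ⟨y, hy, rfl⟩ := List.mem_map.1 (hs ▸ hv)
  exact ⟨y, hW y hy, rfl⟩

theorem Linked.induce {s S : Set V} {p q : V} (h : Linked G S p q) (hS : S ⊆ s) :
    Linked (G.induce s) (Subtype.val ⁻¹' S) ⟨p, hS h.left_mem⟩ ⟨q, hS h.right_mem⟩ := by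
  obtain ⟨W, hW⟩ := h
  refine ⟨W.induce s fun v hv => hS (hW v hv), fun v hv => hW v ?_⟩
  rw [SimpleGraph.Walk.support_induce] at hv
  simpa using hv

theorem coe_ball (r : ℕ) (v : V) : (ball G r v).coe = G.induce (M G r v) :=
  (SimpleGraph.induce_eq_coe_induce_top _).symm

theorem linked_of_isKConnected_ball {r : ℕ} {v c p q : V}
    (h : IsKConnected 2 (ball G r v).coe) (hc : c ∈ M G r v) (hp : p ∈ M G r v)
    (hq : q ∈ M G r v) (hpc : p ≠ c) (hqc : q ≠ c) : Linked G {c}ᶜ p q := by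
  have h' : IsKConnected 2 (G.induce (M G r v)) := by rw [← coe_ball]; exact h
  have := (h'.linked (c := ⟨c, hc⟩) (p := ⟨p, hp⟩) (q := ⟨q, hq⟩) (by simpa using hpc)
    (by simpa using hqc)).of_induce
  refine this.mono ?_
  rintro _ ⟨y, hy, rfl⟩ hyc
  exact hy (Subtype.ext hyc)

theorem isKConnected_ball_of_linked {r : ℕ} {v : V} (hcard : 2 < (M G r v).encard)
    (h : ∀ c ∈ M G r v, ∀ p ∈ M G r v, ∀ q ∈ M G r v, p ≠ c → q ≠ c →
      Linked G (M G r v \ {c}) p q) : IsKConnected 2 (ball G r v).coe := by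
  have : IsKConnected 2 (G.induce (M G r v)) := by
    refine isKConnected_two_of_linked hcard fun c p q hp hq => ?_
    refine ((h c c.2 p p.2 q q.2 (fun h => hp (Subtype.ext h))
      (fun h => hq (Subtype.ext h))).induce (s := M G r v) Set.sdiff_subset).mono ?_
    intro w hw hwc
    exact hw.2 (congrArg Subtype.val hwc)
  rw [← coe_ball] at this
  exact this

theorem mem_M (hG : G.Connected) {r : ℕ} {v w : V} : w ∈ M G r v ↔ G.dist v w ≤ r := by
  change G.edist v w ≤ r ↔ _
  rw [← (hG v w).coe_dist_eq_edist, Nat.cast_le]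

theorem isInterior_of_subset {r : ℕ} {v x : V} (hx : x ∈ M G r v)
    (h : M G 1 x ⊆ M G r v) : IsInterior G r v x :=
  ⟨hx, SimpleGraph.Subgraph.induce_mono_right h⟩

theorem isInterior_of_dist_lt (hG : G.Connected) {r : ℕ} {v x : V} (h : G.dist v x < r) :
    IsInterior G r v x := by
  refine isInterior_of_subset ((mem_M hG).2 h.le) fun w hw => (mem_M hG).2 ?_
  have := (mem_M hG).1 hw
  have := hG.dist_triangle (u := v) (v := x) (w := w)
  omega

theorem exists_dist_eq (hG : G.Connected) {v w : V} {k : ℕ} (hk : k ≤ G.dist v w) :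
    ∃ z, G.dist v z = k ∧ G.dist z w + k = G.dist v w := by
  obtain ⟨W, hW⟩ := hG.exists_walk_length_eq_dist v w
  have h1 := G.dist_le (W.take k)
  have h2 := G.dist_le (W.drop k)
  have h3 := hG.dist_triangle (u := v) (v := W.getVert k) (w := w)
  rw [SimpleGraph.Walk.take_length] at h1
  rw [SimpleGraph.Walk.drop_length] at h2
  exact ⟨W.getVert k, by omega, by omega⟩

theorem not_adj_of_two_le_dist {v w : V} (h : 2 ≤ G.dist v w) : v ≠ w ∧ ¬ G.Adj v w := by
  constructor
  · rintro rfl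
    simp at h
  · intro h'
    rw [SimpleGraph.dist_eq_one_iff_adj.2 h'] at h
    omega

theorem not_adj_both_of_three_le_dist (hG : G.Connected) {v w z : V} (h : 3 ≤ G.dist v w)
    (hv : G.Adj v z) : ¬ G.Adj w z := by
  intro hw
  have := hG.dist_triangle (u := v) (v := z) (w := w)
  rw [SimpleGraph.dist_eq_one_iff_adj.2 hv, SimpleGraph.dist_eq_one_iff_adj.2 hw.symm] at this
  omega

/-- The degree sum of three vertices whose neighbourhoods in `A` overlap in at most one vertex. -/
theorem degree_sum_le_of_overlap [Fintype V] [DecidableRel G.Adj] {x y z u : V} {A : Finset V}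
    (hx : ∀ w, G.Adj x w → w ∈ A) (hy : ∀ w, G.Adj y w → w ∈ A) (hz : ∀ w, G.Adj z w → w ∈ A)
    (hxy : ∀ w, G.Adj x w → ¬ G.Adj y w) (hxz : ∀ w, G.Adj x w → ¬ G.Adj z w)
    (hyz : ∀ w, G.Adj y w → G.Adj z w → w = u) :
    G.degree x + G.degree y + G.degree z ≤ A.card + 1 := by
  classical
  have h1 : (G.neighborFinset y ∩ G.neighborFinset z).card ≤ 1 :=
    (Finset.card_le_card (t := {u}) fun w hw => by
      simp only [Finset.mem_inter, SimpleGraph.mem_neighborFinset] at hw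
      simpa using hyz w hw.1 hw.2).trans (by simp)
  have h2 := Finset.card_union_add_card_inter (G.neighborFinset y) (G.neighborFinset z)
  have h3 : Disjoint (G.neighborFinset x) (G.neighborFinset y ∪ G.neighborFinset z) := by
    rw [Finset.disjoint_left]
    intro w hw hw'
    simp only [Finset.mem_union, SimpleGraph.mem_neighborFinset] at hw hw'
    exact hw'.elim (hxy w hw) (hxz w hw)
  have h4 := Finset.card_union_of_disjoint h3
  have h5 : (G.neighborFinset x ∪ (G.neighborFinset y ∪ G.neighborFinset z)).card ≤ A.card := by
    refine Finset.card_le_card fun w hw => ?_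
    simp only [Finset.mem_union, SimpleGraph.mem_neighborFinset] at hw
    rcases hw with h | h | h
    exacts [hx w h, hy w h, hz w h]
  simp only [SimpleGraph.card_neighborFinset_eq_degree] at *
  omega

/-! ### Bounding the radius -/

/-- A connected graph in which no ball of radius three contains three vertices at pairwise distance
at least three has radius at most four. -/
theorem exists_forall_dist_le_four (hG : G.Connected)
    (hF : ∀ c x y z, G.dist c x ≤ 3 → G.dist c y ≤ 3 → G.dist c z ≤ 3 → 3 ≤ G.dist x y →
      3 ≤ G.dist x z → 3 ≤ G.dist y z → False) : ∃ v, ∀ w, G.dist v w ≤ 4 := by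
  by_contra! hcon
  have tri := fun u v w => hG.dist_triangle (u := u) (v := v) (w := w)
  have comm := fun u v => G.dist_comm (u := u) (v := v)
  have hfar : ∀ v, ∃ w, G.dist v w = 5 := fun v => by
    obtain ⟨w, hw⟩ := hcon v
    obtain ⟨z, hz, -⟩ := exists_dist_eq hG hw
    exact ⟨z, hz⟩
  -- At distance 6, the two ends and the midpoint of a geodesic lie in the ball of radius 3 about
  -- the midpoint.
  have hdiam : ∀ v w, G.dist v w ≤ 5 := fun v w => by
    by_contra! h
    obtain ⟨z, hz, hzw⟩ := exists_dist_eq hG (k := 6) (v := v) (w := w) (by omega)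
    obtain ⟨c, hc, hcz⟩ := exists_dist_eq hG (k := 3) (v := v) (w := z) (by omega)
    have := comm v c
    exact hF c v c z (by omega) (by simp) (by omega) (by omega) (by omega) (by omega)
  obtain ⟨v⟩ := hG.nonempty
  obtain ⟨w, hvw⟩ := hfar v
  -- The vertices `v`, `y₁`, `y₂`, `c` start a geodesic to `w`, so `c` is at distance 3 from `v` and
  -- 2 from `w`.
  obtain ⟨y₁, hy₁, hy₁w⟩ := exists_dist_eq hG (k := 1) (v := v) (w := w) (by omega)
  obtain ⟨y₂, hy₂, hy₂w⟩ := exists_dist_eq hG (k := 1) (v := y₁) (w := w) (by omega)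
  obtain ⟨c, hc, hcw⟩ := exists_dist_eq hG (k := 1) (v := y₂) (w := w) (by omega)
  have e₁ := tri v y₁ y₂
  have e₂ := tri v y₂ c
  have e₃ := tri v c w
  have e₄ := tri y₁ y₂ c
  have e₅ := tri y₁ c w
  obtain ⟨t, hct⟩ := hfar c
  -- The triangle inequality gives at least 2. If the distance were larger, `v`, `c` and a vertex
  -- `t'` at distance 3 from `v` towards `t` would be a forbidden triple about `v`.
  have hvt : G.dist v t = 2 := by
    have := tri c v t
    have := comm c v
    by_contra hne
    obtain ⟨t', ht', ht't⟩ := exists_dist_eq hG (k := 3) (v := v) (w := t) (by omega)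
    have := hdiam v t
    have := tri c t' t
    exact hF v v c t' (by simp) (by omega) (by omega) (by omega) (by omega) (by omega)
  have hty₁ : G.dist t y₁ = 3 := by
    have := tri t v y₁
    have := tri t y₁ c
    have := comm t v
    have := comm t c
    omega
  obtain ⟨z, hz, hzw⟩ := exists_dist_eq hG (k := 3) (v := t) (w := w) (by
    have := tri v t w
    omega)
  have htw : G.dist t w = 5 := by
    have := hdiam t w
    have := tri y₁ z w
    by_contra hne
    exact hF t t y₁ z (by simp) (by omega) (by omega) (by omega) (by omega) (by omega)
  -- The ball about `b` will contain the contradictory triple `t`, `w`, `y₁`; the path through `y₂`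
  -- keeps `y₁` within distance 3 of `b`.
  obtain ⟨b, hb, hbw⟩ := exists_dist_eq hG (k := 2) (v := t) (w := w) (by omega)
  have hwb := comm w b
  have hwy₂ := comm w y₂
  have hy₂b : G.dist y₂ b ≤ 2 := by
    by_contra hne
    exact hF w w y₂ b (by simp) (by omega) (by omega) (by omega) (by omega) (by omega)
  have := tri y₁ y₂ b
  have := comm b t
  have := comm b y₁
  have := comm w y₁
  exact hF b t w y₁ (by omega) (by omega) (by omega) (by omega) (by omega) (by omega)

/-! ### Equivalence of the local and global conditions -/

section

variable [Fintype V] [DecidableRel G.Adj]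

/-- Walk from each vertex up to a neighbour of `c`; the neighbours of `c` lie in the ball about `c`,
which stays connected without `c`. -/
theorem LocalCondition.isKConnected (h : LocalCondition G) : IsKConnected 2 G := by
  obtain ⟨hG, hcard, hball, -⟩ := h
  refine isKConnected_two_of_linked ?_ fun c p q hp hq => ?_
  · rw [ENat.card_eq_coe_fintype_card]
    exact_mod_cast hcard
  · have key : ∀ p, p ≠ c → ∃ y, Linked G {c}ᶜ p y ∧ G.Adj y c := by
      intro p hp
      obtain ⟨W⟩ := hG p c
      obtain ⟨y, d, hy, hd, hyd, -⟩ := Linked.exists_boundary (S := Set.univ) ⟨W, by simp⟩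
        {c}ᶜ hp (by simp)
      have hdc : d = c := by simpa using hd
      exact ⟨y, hy.mono Set.inter_subset_right, hdc ▸ hyd⟩
    obtain ⟨y, hpy, hy⟩ := key p hp
    obtain ⟨z, hqz, hz⟩ := key q hq
    have hM : ∀ y, G.Adj y c → y ∈ M G 4 c := fun y hy => (mem_M hG).2 (by
      rw [SimpleGraph.dist_eq_one_iff_adj.2 hy.symm]
      norm_num)
    exact (hpy.trans (linked_of_isKConnected_ball (hball c) ((mem_M hG).2 (by simp)) (hM y hy)
      (hM z hz) hy.ne hz.ne)).trans hqz.symm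

theorem LocalCondition.exists_forall_dist_le_four (h : LocalCondition G) :
    ∃ v, ∀ w, G.dist v w ≤ 4 := by
  classical
  obtain ⟨hG, -, -, hdeg⟩ := h
  refine LocalBondy.exists_forall_dist_le_four hG fun c x y z hx hy hz hxy hxz hyz => ?_
  have axy := not_adj_of_two_le_dist (show 2 ≤ G.dist x y by omega)
  have axz := not_adj_of_two_le_dist (show 2 ≤ G.dist x z by omega)
  have ayz := not_adj_of_two_le_dist (show 2 ≤ G.dist y z by omega)
  have h1 := hdeg c x y z (isInterior_of_dist_lt hG (by omega))
    (isInterior_of_dist_lt hG (by omega)) (isInterior_of_dist_lt hG (by omega))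
    (isIndepTriple_of_not_adj axy.1 axz.1 ayz.1 axy.2 axz.2 ayz.2)
  have hM : ∀ x w, G.dist c x ≤ 3 → G.Adj x w → w ∈ (M G 4 c).toFinset := by
    intro x w hx hxw
    rw [Set.mem_toFinset, mem_M hG]
    have := hG.dist_triangle (u := c) (v := x) (w := w)
    rw [SimpleGraph.dist_eq_one_iff_adj.2 hxw] at this
    omega
  have h2 := degree_sum_le_of_overlap (u := c) (fun w => hM x w hx) (fun w => hM y w hy)
    (fun w => hM z w hz) (fun w => not_adj_both_of_three_le_dist hG hxy)
    (fun w => not_adj_both_of_three_le_dist hG hxz)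
    (fun w hw hw' => absurd hw' (not_adj_both_of_three_le_dist hG hyz hw))
  rw [Set.ncard_eq_toFinset_card'] at h1
  omega

theorem LocalCondition.bondyCondition (h : LocalCondition G) : BondyCondition G := by
  refine ⟨h.isKConnected, fun x y z hxyz => ?_⟩
  obtain ⟨v, hv⟩ := h.exists_forall_dist_le_four
  have hM : M G 4 v = Set.univ := Set.eq_univ_of_forall fun w => (mem_M h.1).2 (hv w)
  have hint : ∀ x, IsInterior G 4 v x := fun x =>
    isInterior_of_subset (hM ▸ Set.mem_univ x) (hM ▸ Set.subset_univ _)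
  have := h.2.2.2 v x y z (hint x) (hint y) (hint z) hxyz
  rwa [hM, Set.ncard_univ, Nat.card_eq_fintype_card] at this

/-- As the ball misses `w`, every vertex of it other than `c` can reach the sphere of radius 4
inside the ball minus `c`. It remains to join these sphere vertices to one another, or to the
centre, through a vertex at distance 3. -/
theorem BondyCondition.linked_ball (h : BondyCondition G) {v w c p q : V} (hw : w ∉ M G 4 v)
    (hc : c ∈ M G 4 v) (hp : p ∈ M G 4 v) (hq : q ∈ M G 4 v) (hpc : p ≠ c) (hqc : q ≠ c) :
    Linked G (M G 4 v \ {c}) p q := by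
  have hG := h.1.connected
  have hadj : ∀ {y z}, G.Adj y z → G.dist v z ≤ G.dist v y + 1 := fun {y z} hyz => by
    have := hG.dist_triangle (u := v) (v := y) (w := z)
    rwa [SimpleGraph.dist_eq_one_iff_adj.2 hyz] at this
  have hwc : w ≠ c := fun e => hw (e ▸ hc)
  have outer : ∀ p ∈ M G 4 v, p ≠ c → ∃ y, Linked G (M G 4 v \ {c}) p y ∧ G.dist v y = 4 := by
    intro p hp hpc
    obtain ⟨y, d, hy, hd, hyd, -⟩ := (h.1.linked hpc hwc).exists_boundary (M G 4 v) hp hw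
    refine ⟨y, hy.mono fun z hz => ⟨hz.2, hz.1⟩, ?_⟩
    have h1 := (mem_M hG).1 hy.right_mem.2
    have h2 := hadj hyd
    rw [mem_M hG] at hd
    omega
  -- Otherwise `v`, `x`, `y` are independent. Distance at least 3 keeps the neighbourhood of `v`
  -- disjoint from the other two, and neighbours of `x` stay in the ball, so `x` and `y` share at
  -- most `c`; the degree sum is at most |V| + 1.
  have middle : ∀ x y, x ≠ c → y ≠ c → G.dist v x = 3 → G.dist v y = 4 →
      Linked G (M G 4 v \ {c}) x y := by
    intro x y hx hy hvx hvy
    by_contra hxy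
    have hxM : x ∈ M G 4 v \ {c} := ⟨(mem_M hG).2 (by omega), hx⟩
    have hyM : y ∈ M G 4 v \ {c} := ⟨(mem_M hG).2 (by omega), hy⟩
    have avx := not_adj_of_two_le_dist (show 2 ≤ G.dist v x by omega)
    have avy := not_adj_of_two_le_dist (show 2 ≤ G.dist v y by omega)
    have h1 := h.2 v x y (isIndepTriple_of_not_adj avx.1 avy.1
      (fun e => hxy (e ▸ .refl hxM)) avx.2 avy.2 (fun e => hxy (.of_adj e hxM hyM)))
    have h2 := degree_sum_le_of_overlap (x := v) (y := x) (z := y) (u := c) (A := Finset.univ)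
      (by simp) (by simp) (by simp)
      (fun w => not_adj_both_of_three_le_dist hG (by omega))
      (fun w => not_adj_both_of_three_le_dist hG (by omega)) fun z hxz hyz => by
        by_contra hzc
        have hzM : z ∈ M G 4 v \ {c} := ⟨(mem_M hG).2 (by have := hadj hxz; omega), hzc⟩
        exact hxy ((Linked.of_adj hxz hxM hzM).trans (.of_adj hyz.symm hzM hyM))
    rw [Finset.card_univ] at h2
    omega
  by_cases hvc : v = c
  · obtain ⟨y, hpy, hvy⟩ := outer p hp hpc
    obtain ⟨z, hqz, hvz⟩ := outer q hq hqc
    obtain ⟨x, hvx, hxy⟩ := exists_dist_eq hG (k := 3) (v := v) (w := y) (by omega)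
    have hxc : x ≠ c := by
      rintro rfl
      simp [hvc] at hvx
    have hxy' : G.Adj x y := SimpleGraph.dist_eq_one_iff_adj.1 (by omega)
    exact (hpy.trans (.of_adj hxy'.symm hpy.right_mem ⟨(mem_M hG).2 (by omega), hxc⟩)).trans
      ((middle x z hxc hqz.right_mem.2 hvx hvz).trans hqz.symm)
  · have hroot : ∀ q ∈ M G 4 v, q ≠ c → Linked G (M G 4 v \ {c}) v q := by
      intro q hq hqc
      obtain ⟨y, hvy, hy⟩ := outer v ((mem_M hG).2 (by simp)) hvc
      obtain ⟨z, hqz, hz⟩ := outer q hq hqc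
      -- On the way from `v` to distance 4, the first vertex beyond distance 2 is at distance
      -- exactly 3.
      obtain ⟨d, x, hd, hx, hdx, hxS⟩ := hvy.exists_boundary {z | G.dist v z ≤ 2}
        (by simp) (by simp [hy])
      have h1 : G.dist v d ≤ 2 := hd.right_mem.2
      have h2 : ¬ G.dist v x ≤ 2 := hx
      have h3 := hadj hdx
      have hd' := hd.mono Set.inter_subset_left
      exact (hd'.trans (.of_adj hdx hd'.right_mem hxS)).trans
        ((middle x z hxS.2 hqz.right_mem.2 (by omega) hz).trans hqz.symm)
    exact (hroot p hp hpc).symm.trans (hroot q hq hqc)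

theorem BondyCondition.isKConnected_ball (h : BondyCondition G) (v : V) :
    IsKConnected 2 (ball G 4 v).coe := by
  have hG := h.1.connected
  by_cases hM : M G 4 v = Set.univ
  · refine isKConnected_ball_of_linked ?_ fun c _ p _ q _ hp hq => ?_
    · rw [hM, Set.encard_univ]
      exact h.1.1
    · exact (h.1.linked hp hq).mono fun z hz => ⟨hM ▸ Set.mem_univ z, hz⟩
  · obtain ⟨w, hw⟩ := (Set.ne_univ_iff_exists_notMem _).1 hM
    refine isKConnected_ball_of_linked ?_ fun c hc p hp q hq => h.linked_ball hw hc hp hq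
    rw [mem_M hG, not_le] at hw
    obtain ⟨y, hy, -⟩ := exists_dist_eq hG (k := 1) (v := v) (w := w) (by omega)
    obtain ⟨z, hz, -⟩ := exists_dist_eq hG (k := 2) (v := v) (w := w) (by omega)
    rw [← (Set.toFinite _).cast_ncard_eq]
    have : 2 < (M G 4 v).ncard := (Set.two_lt_ncard_iff (Set.toFinite _)).2
      ⟨v, y, z, (mem_M hG).2 (by simp), (mem_M hG).2 (by omega), (mem_M hG).2 (by omega),
        fun e => by simp [← e] at hy, fun e => by simp [← e] at hz, fun e => by
          rw [e] at hy
          omega⟩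
    exact_mod_cast this

theorem BondyCondition.localCondition (h : BondyCondition G) : LocalCondition G := by
  refine ⟨h.1.connected, ?_, h.isKConnected_ball, fun v x y z _ _ _ hxyz => ?_⟩
  · have := h.1.1
    rw [ENat.card_eq_coe_fintype_card] at this
    exact_mod_cast this
  · have h1 := h.2 x y z hxyz
    have h2 := Set.ncard_le_card (M G 4 v)
    rw [Nat.card_eq_fintype_card] at h2
    omega

end

end LocalBondy

theorem mainTheorem7 {V : Type*} [Fintype V] (G : SimpleGraph V) [DecidableRel G.Adj] :
    (LocalBondy.LocalCondition G →
      ∀ (a : V) (C : G.Walk a a),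
        LocalBondy.IsLongestCycle G C → LocalBondy.IsDominating G C) ∧
    (LocalBondy.LocalCondition G ↔ LocalBondy.BondyCondition G) :=
  ⟨fun h _ _ hC => h.bondyCondition.isDominating hC,
    fun h => h.bondyCondition, fun h => h.localCondition⟩
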